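/- Let $(G,P,\Delta)$ be a Garside structure of finite type on a group $G$, with prefix order $a\preccurlyeq b\Leftrightarrow a^{-1}b\in P$, and write $x^a=a^{-1}xa$. For $x\in G$ let $\inf(x)$ and $\sup(x)$ be the maximal and minimal integers with $\Delta^{\inf(x)}\preccurlyeq x\preccurlyeq\Delta^{\sup(x)}$, let $\mathfrak p(x)=(x\Delta^{-\inf(x)})\wedge(x^{-1}\Delta^{\sup(x)})\wedge\Delta$ be the preferred prefix and $\mathfrak s(x)=x^{\mathfrak p(x)}$ the cyclic sliding. Let $\mathrm{SSS}(x)$ be the set of conjugates $y$ of $x$ with $\inf(y)$ maximal and $\sup(y)$ minimal in the conjugacy class of $x$, and $\mathrm{SC}(x)$ the set of conjugates $y$ of $x$ with $\mathfrak s^m(y)=y$ for some $m\ge 1$. Simple elements are the $s\in G$ with $1\preccurlyeq s\preccurlyeq\Delta$. The transport of $a$ at $z$ is $a^{(1)}=\mathfrak p(z)^{-1}\,a\,\mathfrak p(z^a)$; iterated transports at $z$ are $a^{(0)}=a$ and, for $i\ge1$, $a^{(i)}=$ the transport of $a^{(i-1)}$ at $\mathfrak s^{i-1}(z)$. For $y\in\mathrm{SC}(x)$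 let $z$ be the element of the sliding circuit of $y$ with $\mathfrak s(z)=y$. The pullback $s_{(1)}$ at $y$ of a positive element $s$ is the $\preccurlyeq$-minimum of the positive elements $t$ such that $z^t\in\mathrm{SSS}(x)$ and $s$ is a prefix of the transport of $t$ at $z$; iterated pullbacks at $y$ are $s_{(0)}=s$ and, for $k\ge1$, $s_{(k)}=$ the pullback of $s_{(k-1)}$ at the element $w$ of the circuit of $y$ with $\mathfrak s^{k-1}(w)=y$. **Corollary.** Let $x\in G$. For each $z\in\mathrm{SC}(x)$ fix a positive integer $N=N_z$ with $\mathfrak s^{N}(z)=z$ (for example, the length of the sliding circuit of $z$). Let $R$ be an integer such that for every $z\in\mathrm{SC}(x)$ and every simple element $s$ with $z^s\in\mathrm{SSS}(x)$ there are integers $0\le i<j\le R$ with $s^{(iN)}=s^{(jN)}$, the transports being taken at $z$. Then for every $z\in\mathrm{SC}(x)$ and every simple element $s$ with $z^s\in\mathrm{SSS}(x)$ all iterated pullbacks $s_{(m)}$ at $z$ exist, and there are integers $0\le i<j\le 2R$ with $s_{(iN)}=s_{(jN)}$. -/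

import Mathlib

/-- A Garside structure `(G, P, Δ)` on a group `G`: a submonoid `P` of positive elements and a
Garside element `Δ ∈ P` such that `a ≼ b ↔ a⁻¹ * b ∈ P` is a lattice order, the elements between
`1` and `Δ` generate `G`, conjugation by `Δ` preserves `P`, and the number of factors in
decompositions of a nontrivial positive element into nontrivial positive elements is bounded. -/
structure GarsideStructure (G : Type*) [Group G] where
  /-- the monoid of positive elements -/
  P : Submonoid G
  /-- the Garside element -/
  Δ : G
  Δ_mem : Δ ∈ P
  eq_one_of_mem_of_inv_mem : ∀ a : G, a ∈ P → a⁻¹ ∈ P → a = 1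
  exists_gcd : ∀ a b : G, ∃ d : G, d⁻¹ * a ∈ P ∧ d⁻¹ * b ∈ P ∧
    ∀ e : G, e⁻¹ * a ∈ P → e⁻¹ * b ∈ P → e⁻¹ * d ∈ P
  exists_lcm : ∀ a b : G, ∃ m : G, a⁻¹ * m ∈ P ∧ b⁻¹ * m ∈ P ∧
    ∀ e : G, a⁻¹ * e ∈ P → b⁻¹ * e ∈ P → m⁻¹ * e ∈ P
  closure_simples : Subgroup.closure {s : G | s ∈ P ∧ s⁻¹ * Δ ∈ P} = ⊤
  conj_mem_iff : ∀ a : G, Δ⁻¹ * a * Δ ∈ P ↔ a ∈ P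
  exists_length_bound : ∀ x : G, x ∈ P → x ≠ 1 → ∃ n : ℕ, ∀ L : List G,
    (∀ a ∈ L, a ∈ P ∧ a ≠ 1) → L.prod = x → L.length ≤ n

namespace GarsideStructure

noncomputable section

variable {G : Type*} [Group G] (D : GarsideStructure G)

/-- The prefix order `a ≼ b`. -/
def le (a b : G) : Prop := a⁻¹ * b ∈ D.P

/-- The set `[1, Δ]` of simple elements. -/
def simples : Set G := {s : G | D.le 1 s ∧ D.le s D.Δ}

/-- The Garside structure is of finite type. -/
def FiniteType : Prop := D.simples.Finite

/-- The greatest common divisor `a ∧ b` with respect to `≼`. -/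
def gcd (a b : G) : G := Classical.choose (D.exists_gcd a b)

/-- `inf x` is the maximal integer `k` with `Δ ^ k ≼ x`. -/
def inf (x : G) : ℤ := sSup {k : ℤ | D.le (D.Δ ^ k) x}

/-- `sup x` is the minimal integer `k` with `x ≼ Δ ^ k`. -/
def sup (x : G) : ℤ := sInf {k : ℤ | D.le x (D.Δ ^ k)}

/-- The super summit set of `x`: the conjugates `y` of `x` such that `inf y` is the maximum of `inf`
and `sup y` is the minimum of `sup` on the conjugacy class of `x`. -/
def SSS (x : G) : Set G :=
  {y : G | IsConj x y ∧
    IsGreatest (D.inf '' {w : G | IsConj x w}) (D.inf y) ∧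
    IsLeast (D.sup '' {w : G | IsConj x w}) (D.sup y)}

/-- The conjugate `x ^ a = a⁻¹ x a`. -/
def conj (x a : G) : G := a⁻¹ * x * a

/-- The preferred prefix `𝔭(x) = (x Δ ^ (-inf x)) ∧ (x⁻¹ Δ ^ (sup x)) ∧ Δ`. -/
def preferredPrefix (x : G) : G :=
  D.gcd (D.gcd (x * D.Δ ^ (-D.inf x)) (x⁻¹ * D.Δ ^ D.sup x)) D.Δ

/-- The cyclic sliding `𝔰(x) = x ^ 𝔭(x)`. -/
def sliding (x : G) : G := conj x (D.preferredPrefix x)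

/-- The set of sliding circuits of `x`: the conjugates `y` of `x` with `𝔰^m(y) = y` for some
`m ≥ 1`. -/
def SC (x : G) : Set G := {y : G | IsConj x y ∧ ∃ m : ℕ, 1 ≤ m ∧ D.sliding^[m] y = y}

/-- The transport of `a` at `x` under cyclic sliding, `𝔭(x)⁻¹ a 𝔭(x ^ a)`. -/
def transport (x a : G) : G := (D.preferredPrefix x)⁻¹ * a * D.preferredPrefix (conj x a)

/-- The iterated transport `a^(i)` at `x`; the last step is taken at `𝔰^(i-1)(x)`. -/
def iterTransport (x a : G) : ℕ → G
  | 0 => a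
  | i + 1 => D.transport (D.sliding^[i] x) (iterTransport x a i)

/-- For `y` on a sliding circuit, the element `z` of that circuit with `𝔰(z) = y`. (If the circuit
has length `n`, this is `𝔰^(n-1)(y)`.) -/
def prev (y : G) : G := D.sliding^[Function.minimalPeriod D.sliding y - 1] y

/-- `t` is the pullback of `s` at `y`, for `y` in the set of sliding circuits of `x`: with `z` the
predecessor of `y` on its circuit, `t` is the `≼`-least positive element for which `z ^ t` is super
summit and `s` is a prefix of the transport of `t` at `z`. -/
def IsPullback (x y s t : G) : Prop :=
  (D.le 1 t ∧ conj (D.prev y) t ∈ D.SSS x ∧ D.le s (D.transport (D.prev y) t)) ∧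
  ∀ t' : G, D.le 1 t' → conj (D.prev y) t' ∈ D.SSS x → D.le s (D.transport (D.prev y) t') →
    D.le t t'

/-- The pullback of `s` at `y`, the unique `t` with `IsPullback x y s t`. -/
def pullback (x y s : G) : G := Classical.epsilon (D.IsPullback x y s)

/-- The iterated pullback `s_(k)` at `y`; the last step is taken at the element `w` of the circuit
of `y` with `𝔰^(k-1)(w) = y`. -/
def iterPullback (x y s : G) : ℕ → G
  | 0 => s
  | k + 1 => D.pullback x (D.prev^[k] y) (iterPullback x y s k)

/-- `R` bounds the distance to transport repetition for `x`, where transports at `z` are taken in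
steps of `N z`: for all `z ∈ SC(x)` and simple `s` with `z ^ s ∈ SSS(x)` there are `i < j ≤ R` with
`s^(i N) = s^(j N)`. -/
def IsTransportBound (x : G) (N : G → ℕ) (R : ℕ) : Prop :=
  ∀ z ∈ D.SC x, ∀ s ∈ D.simples, conj z s ∈ D.SSS x →
    ∃ i j : ℕ, i < j ∧ j ≤ R ∧ D.iterTransport z s (i * N z) = D.iterTransport z s (j * N z)

end

end GarsideStructure

namespace GarsideStructure

variable {G : Type*} [Group G] (D : GarsideStructure G)

/-! ### The prefix order -/

/-! Iterated pullback is left adjoint to iterated transport (`iterPullback_le_iff`). Let `F` be the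
`N`-fold transport at `z`, a monotone self-map of the set `V` of simple `t` with `z^t` super summit,
and let `g i` be the pullback of `s` in `i * N` steps. Then `g i ≼ t` iff `s ≼ F^i t`, so the
repetition of `F`-orbits passes to `g` (`exists_repetition_of_adjunction`). Every orbit is periodic
from step `R` on. If `c = F^R (g R)` has period `p ≤ R`, then `s ≼ c = F^(R+p) (g R)`, hence `g
(R+p) ≼ g R`. Conversely, `s ≼ F^(R+p) (g (R+p))` gives `g R ≼ F^p (g (R+p))`. Applying `F^R` and
going round the two cycles yields `c ≼ F^R (g (R+p))`, hence `g R ≼ g (R+p)`.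

Pullbacks exist because the candidates contain `Δ` and are closed under gcd (`exists_isPullback`).
This requires `SC_subset_SSS`, which rests on a closed form for iterated sliding on a circuit
(`iterate_sliding_eq`): if some conjugate had larger infimum, the gcds in that form would stabilize
and force the infimum to grow along the circuit (`inf_conj_le_inf`). The statement for suprema
follows by inversion. -/

lemma le_refl (a : G) : D.le a a := by simp [le, D.P.one_mem]

variable {D} in
lemma le.trans {a b c : G} (h : D.le a b) (h' : D.le b c) : D.le a c := by
  have := D.P.mul_mem h h'
  simpa [le, mul_assoc] using this

variable {D} in
lemma le.antisymm {a b : G} (h : D.le a b) (h' : D.le b a) : a = b := by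
  have := D.eq_one_of_mem_of_inv_mem (a⁻¹ * b) h (by simpa [le] using h')
  exact inv_mul_eq_one.mp this

lemma eq_of_forall_le_iff {a b : G} (h : ∀ e, D.le e a ↔ D.le e b) : a = b :=
  ((h a).1 (D.le_refl a)).antisymm ((h b).2 (D.le_refl b))

lemma mul_le_mul_left_iff (c a b : G) : D.le (c * a) (c * b) ↔ D.le a b := by
  simp [le, mul_assoc]

lemma inv_mul_le_iff (c a b : G) : D.le (c⁻¹ * a) b ↔ D.le a (c * b) := by
  simp [le, mul_assoc]

lemma le_inv_mul_iff (c a b : G) : D.le a (c⁻¹ * b) ↔ D.le (c * a) b := by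
  simp [le, mul_assoc]

lemma one_le_iff (a : G) : D.le 1 a ↔ a ∈ D.P := by simp [le]

lemma le_mul_of_mem (a : G) {b : G} (hb : b ∈ D.P) : D.le a (a * b) := by simpa [le] using hb

lemma conj_pow_mem_iff (n : ℕ) (a : G) : D.Δ⁻¹ ^ n * a * D.Δ ^ n ∈ D.P ↔ a ∈ D.P := by
  induction n with
  | zero => simp
  | succ n ih =>
    rw [← ih, ← D.conj_mem_iff (D.Δ⁻¹ ^ n * a * D.Δ ^ n), pow_succ' D.Δ⁻¹, pow_succ D.Δ]
    simp only [mul_assoc]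

lemma conj_zpow_mem_iff (k : ℤ) (a : G) : D.Δ ^ (-k) * a * D.Δ ^ k ∈ D.P ↔ a ∈ D.P := by
  obtain ⟨n, rfl | rfl⟩ := k.eq_nat_or_neg
  · simpa using D.conj_pow_mem_iff n a
  · rw [← D.conj_pow_mem_iff n (D.Δ ^ (- -(n : ℤ)) * a * D.Δ ^ (-(n : ℤ)))]
    simp [mul_assoc]

/-- Conjugation by `Δ` preserves `P`, so powers of `Δ` also act from the right by order
automorphisms. Hence gcds commute with right multiplication by `Δ ^ k`. -/
lemma mul_zpow_le_mul_zpow_iff (k : ℤ) (a b : G) :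
    D.le (a * D.Δ ^ k) (b * D.Δ ^ k) ↔ D.le a b := by
  rw [le, le, ← D.conj_zpow_mem_iff k (a⁻¹ * b)]
  simp [mul_assoc]

lemma mul_zpow_le_iff (k : ℤ) (a b : G) : D.le (a * D.Δ ^ k) b ↔ D.le a (b * D.Δ ^ (-k)) := by
  rw [← D.mul_zpow_le_mul_zpow_iff (-k)]
  simp [mul_assoc]

lemma zpow_mem {k : ℤ} (hk : 0 ≤ k) : D.Δ ^ k ∈ D.P := by
  obtain ⟨n, rfl⟩ := Int.eq_ofNat_of_zero_le hk
  simpa using D.P.pow_mem D.Δ_mem n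

lemma zpow_le_zpow {k l : ℤ} (h : k ≤ l) : D.le (D.Δ ^ k) (D.Δ ^ l) := by
  have := D.zpow_mem (sub_nonneg.2 h)
  rw [le, ← zpow_neg, ← zpow_add]
  convert this using 2
  ring

lemma mul_zpow_le_mul_zpow (a : G) {k l : ℤ} (h : k ≤ l) :
    D.le (a * D.Δ ^ k) (a * D.Δ ^ l) :=
  (D.mul_le_mul_left_iff _ _ _).2 (D.zpow_le_zpow h)

lemma zpow_le_inv_iff (k : ℤ) (a : G) : D.le (D.Δ ^ k) a⁻¹ ↔ D.le a (D.Δ ^ (-k)) := by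
  have := D.mul_zpow_le_iff k 1 a⁻¹
  rw [one_mul] at this
  rw [this, D.le_inv_mul_iff, mul_one]

lemma inv_le_zpow_iff (k : ℤ) (a : G) : D.le a⁻¹ (D.Δ ^ k) ↔ D.le (D.Δ ^ (-k)) a := by
  have := D.zpow_le_inv_iff (-k) a⁻¹
  rw [inv_inv, neg_neg] at this
  exact this.symm

lemma le_gcd_iff (e a b : G) : D.le e (D.gcd a b) ↔ D.le e a ∧ D.le e b := by
  obtain ⟨h1, h2, h3⟩ := Classical.choose_spec (D.exists_gcd a b)
  exact ⟨fun h => ⟨h.trans h1, h.trans h2⟩, fun h => h3 e h.1 h.2⟩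

lemma exists_zpow_le_le (a : G) : ∃ k l : ℤ, D.le (D.Δ ^ k) a ∧ D.le a (D.Δ ^ l) := by
  have ha : a ∈ Subgroup.closure {s : G | s ∈ D.P ∧ s⁻¹ * D.Δ ∈ D.P} := by
    rw [D.closure_simples]; trivial
  induction ha using Subgroup.closure_induction with
  | mem s hs => exact ⟨0, 1, by simpa [le] using hs.1, by simpa [le] using hs.2⟩
  | one => exact ⟨0, 0, by simpa using D.le_refl 1, by simpa using D.le_refl 1⟩
  | mul a b _ _ iha ihb =>
    obtain ⟨k, l, h1, h2⟩ := iha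
    obtain ⟨k', l', h3, h4⟩ := ihb
    refine ⟨k + k', l + l', ?_, ?_⟩
    · rw [zpow_add]
      exact ((D.mul_zpow_le_mul_zpow_iff _ _ _).2 h1).trans ((D.mul_le_mul_left_iff _ _ _).2 h3)
    · rw [zpow_add]
      exact ((D.mul_le_mul_left_iff _ _ _).2 h4).trans ((D.mul_zpow_le_mul_zpow_iff _ _ _).2 h2)
  | inv a _ ih =>
    obtain ⟨k, l, h1, h2⟩ := ih
    exact ⟨-l, -k, (D.zpow_le_inv_iff _ _).2 (by simpa using h2),
      (D.inv_le_zpow_iff _ _).2 (by simpa using h1)⟩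

/-- This isolates the degenerate case, where `inf` and `sup` are taken over all of `ℤ` and carry no
meaning. -/
lemma subsingleton_of_Δ_eq_one (h : D.Δ = 1) : Subsingleton G := by
  refine ⟨fun a b => ?_⟩
  have key : ∀ a : G, a = 1 := by
    intro a
    obtain ⟨k, l, h1, h2⟩ := D.exists_zpow_le_le a
    rw [h, one_zpow] at h1 h2
    exact h2.antisymm h1
  rw [key a, key b]

variable {D} in
lemma le_of_zpow_le_zpow (hΔ : D.Δ ≠ 1) {k l : ℤ} (h : D.le (D.Δ ^ k) (D.Δ ^ l)) : k ≤ l := by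
  by_contra! hlt
  have h1 : D.Δ ^ k = D.Δ ^ l := h.antisymm (D.zpow_le_zpow hlt.le)
  -- A coincidence of powers makes `Δ⁻¹` a nonnegative power of `Δ`, hence positive.
  have h2 : D.Δ ^ (k - l - 1) * D.Δ = 1 := by
    rw [← zpow_add_one, sub_add_cancel, zpow_sub, h1, mul_inv_cancel]
  refine hΔ (D.eq_one_of_mem_of_inv_mem _ D.Δ_mem ?_)
  rw [← eq_inv_of_mul_eq_one_left h2]
  exact D.zpow_mem (by omega)

/-! ### Infimum and supremum -/

variable {D} in
lemma le_inf_iff (hΔ : D.Δ ≠ 1) (k : ℤ) (a : G) : k ≤ D.inf a ↔ D.le (D.Δ ^ k) a := by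
  obtain ⟨k₀, l₀, h1, h2⟩ := D.exists_zpow_le_le a
  have hb : BddAbove {k : ℤ | D.le (D.Δ ^ k) a} :=
    ⟨l₀, fun k hk => le_of_zpow_le_zpow hΔ (le.trans hk h2)⟩
  have hm : D.le (D.Δ ^ D.inf a) a := Int.csSup_mem ⟨k₀, h1⟩ hb
  exact ⟨fun h => (D.zpow_le_zpow h).trans hm, fun h => le_csSup hb h⟩

variable {D} in
lemma sup_le_iff (hΔ : D.Δ ≠ 1) (k : ℤ) (a : G) : D.sup a ≤ k ↔ D.le a (D.Δ ^ k) := by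
  obtain ⟨k₀, l₀, h1, h2⟩ := D.exists_zpow_le_le a
  have hb : BddBelow {k : ℤ | D.le a (D.Δ ^ k)} :=
    ⟨k₀, fun k hk => le_of_zpow_le_zpow hΔ (h1.trans hk)⟩
  have hm : D.le a (D.Δ ^ D.sup a) := Int.csInf_mem ⟨l₀, h2⟩ hb
  exact ⟨fun h => hm.trans (D.zpow_le_zpow h), fun h => csInf_le hb h⟩

variable {D} in
lemma inf_inv (hΔ : D.Δ ≠ 1) (a : G) : D.inf a⁻¹ = -D.sup a := by
  refine _root_.eq_of_forall_le_iff fun k => ?_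
  rw [le_inf_iff hΔ, D.zpow_le_inv_iff, ← sup_le_iff hΔ]
  omega

variable {D} in
lemma sup_inv (hΔ : D.Δ ≠ 1) (a : G) : D.sup a⁻¹ = -D.inf a := by
  have := inf_inv hΔ a⁻¹
  rw [inv_inv] at this
  omega

lemma conj_mul (x a b : G) : conj x (a * b) = conj (conj x a) b := by
  simp [conj, mul_assoc]

lemma conj_inv (x a : G) : conj x⁻¹ a = (conj x a)⁻¹ := by
  simp [conj, mul_assoc]

lemma isConj_conj (x a : G) : IsConj x (conj x a) :=
  isConj_iff.2 ⟨a⁻¹, by simp [conj]⟩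

lemma exists_eq_conj {x y : G} (h : IsConj x y) : ∃ a, y = conj x a := by
  obtain ⟨c, rfl⟩ := isConj_iff.1 h
  exact ⟨c⁻¹, by simp [conj]⟩

variable {D} in
lemma le_inf_conj_iff (hΔ : D.Δ ≠ 1) (k : ℤ) (x a : G) :
    k ≤ D.inf (conj x a) ↔ D.le (a * D.Δ ^ k) (x * a) := by
  rw [le_inf_iff hΔ, conj, mul_assoc, D.le_inv_mul_iff]

variable {D} in
lemma sup_conj_le_iff (hΔ : D.Δ ≠ 1) (k : ℤ) (x a : G) :
    D.sup (conj x a) ≤ k ↔ D.le (x * a) (a * D.Δ ^ k) := by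
  rw [sup_le_iff hΔ, conj, mul_assoc, D.inv_mul_le_iff]

/-! ### Descending chain condition -/

lemma exists_length_bound' {x : G} (hx : x ∈ D.P) : ∃ n : ℕ, ∀ L : List G,
    (∀ a ∈ L, a ∈ D.P ∧ a ≠ 1) → L.prod = x → L.length ≤ n := by
  by_cases h : x = 1
  · refine ⟨0, fun L hL hp => ?_⟩
    cases L with
    | nil => simp
    | cons a L =>
      exfalso
      have ha := hL a (by simp)
      have hL' : L.prod ∈ D.P := D.P.list_prod_mem fun b hb => (hL b (by simp [hb])).1
      rw [List.prod_cons, h] at hp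
      exact ha.2 (D.eq_one_of_mem_of_inv_mem a ha.1 (by rwa [inv_eq_of_mul_eq_one_right hp]))
  · exact D.exists_length_bound x hx h

/-- Every nonempty set of positive elements has a minimal element. -/
lemma exists_minimal {A : Set G} (hA : ∀ a ∈ A, a ∈ D.P) (hne : A.Nonempty) :
    ∃ t ∈ A, ∀ t' ∈ A, D.le t' t → t' = t := by
  classical
  let B : G → ℕ → Prop := fun x n => ∀ L : List G,
    (∀ a ∈ L, a ∈ D.P ∧ a ≠ 1) → L.prod = x → L.length ≤ n
  have hex : ∃ n, ∃ t ∈ A, B t n := by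
    obtain ⟨t, ht⟩ := hne
    obtain ⟨n, hn⟩ := D.exists_length_bound' (hA t ht)
    exact ⟨n, t, ht, hn⟩
  -- Take an element with the smallest possible bound on factorization lengths. A proper prefix in
  -- `A` would have a smaller one, since its factorizations extend by the factor `t'⁻¹ * t`.
  obtain ⟨t, ht, hB⟩ := Nat.find_spec hex
  refine ⟨t, ht, fun t' ht' hle => ?_⟩
  by_contra hne'
  have hstep : ∀ L : List G, (∀ a ∈ L, a ∈ D.P ∧ a ≠ 1) → L.prod = t' →
      L.length + 1 ≤ Nat.find hex := by
    intro L hL hp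
    have := hB (L ++ [t'⁻¹ * t]) (by
      intro a ha
      rcases List.mem_append.1 ha with ha | ha
      · exact hL a ha
      · rw [List.mem_singleton.1 ha]
        exact ⟨hle, fun h => hne' (inv_mul_eq_one.1 h)⟩) (by simp [hp])
    simpa using this
  -- One factorization of `t'` shows that the minimal bound is positive, so subtracting 1 is
  -- genuine.
  obtain ⟨L, hL, hp⟩ : ∃ L : List G, (∀ a ∈ L, a ∈ D.P ∧ a ≠ 1) ∧ L.prod = t' := by
    by_cases h : t' = 1
    · exact ⟨[], by simp, by simp [h]⟩
    · exact ⟨[t'], by simpa using ⟨hA _ ht', h⟩, by simp⟩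
  have h1 := hstep L hL hp
  refine Nat.find_min hex (m := Nat.find hex - 1) (by omega) ⟨t', ht', fun L hL hp => ?_⟩
  have := hstep L hL hp
  omega

/-- A nonempty set of positive elements that is closed under greatest common divisors has a
least element. -/
lemma exists_least {A : Set G} (hA : ∀ a ∈ A, a ∈ D.P) (hne : A.Nonempty)
    (hgcd : ∀ a ∈ A, ∀ b ∈ A, D.gcd a b ∈ A) : ∃ t ∈ A, ∀ t' ∈ A, D.le t t' := by
  obtain ⟨t, ht, hmin⟩ := D.exists_minimal hA hne
  refine ⟨t, ht, fun t' ht' => ?_⟩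
  have h := (D.le_gcd_iff _ t t').1 (D.le_refl _)
  have := hmin _ (hgcd t ht t' ht') h.1
  rw [this] at h
  exact h.2

/-- A greatest common divisor of `f 0, …, f n`. -/
noncomputable def gcdUpTo (f : ℕ → G) : ℕ → G
  | 0 => f 0
  | n + 1 => D.gcd (gcdUpTo f n) (f (n + 1))

lemma le_gcdUpTo_iff (f : ℕ → G) (n : ℕ) (e : G) :
    D.le e (D.gcdUpTo f n) ↔ ∀ i ≤ n, D.le e (f i) := by
  induction n with
  | zero => simp [gcdUpTo]
  | succ n ih =>
    rw [gcdUpTo, le_gcd_iff, ih]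
    constructor
    · rintro ⟨h1, h2⟩ i hi
      rcases Nat.lt_or_ge n i with h | h
      · rwa [show i = n + 1 by omega]
      · exact h1 i h
    · exact fun h => ⟨fun i hi => h i (by omega), h _ (by simp)⟩

/-- The greatest common divisors of the initial segments of a sequence that is bounded below
stabilize. -/
lemma exists_gcdUpTo_le {f : ℕ → G} {b : G} (h : ∀ i, D.le b (f i)) :
    ∃ n, D.le (D.gcdUpTo f n) (f (n + 1)) := by
  obtain ⟨t, ⟨n, rfl⟩, hmin⟩ :=
    D.exists_minimal (A := Set.range fun n => b⁻¹ * D.gcdUpTo f n)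
    (by rintro _ ⟨n, rfl⟩; exact (D.le_gcdUpTo_iff f n b).2 fun i _ => h i) ⟨_, 0, rfl⟩
  have hle := (D.le_gcd_iff (D.gcdUpTo f (n + 1)) _ _).1 (D.le_refl _)
  have := hmin (b⁻¹ * D.gcdUpTo f (n + 1)) ⟨n + 1, rfl⟩ ((D.mul_le_mul_left_iff _ _ _).2 hle.1)
  rw [mul_right_inj] at this
  rw [this] at hle
  exact ⟨n, hle.2⟩

/-! ### The preferred prefix and cyclic sliding -/

lemma le_preferredPrefix_iff (e z : G) : D.le e (D.preferredPrefix z) ↔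
    D.le (e * D.Δ ^ D.inf z) z ∧ D.le (z * e) (D.Δ ^ D.sup z) ∧ D.le e D.Δ := by
  rw [preferredPrefix, le_gcd_iff, le_gcd_iff, D.mul_zpow_le_iff, D.le_inv_mul_iff, and_assoc]

lemma le_mul_preferredPrefix_conj_iff (e z a : G) :
    D.le e (a * D.preferredPrefix (conj z a)) ↔
    D.le (e * D.Δ ^ D.inf (conj z a)) (z * a) ∧ D.le (z * e) (a * D.Δ ^ D.sup (conj z a)) ∧
      D.le e (a * D.Δ) := by
  rw [← D.inv_mul_le_iff, le_preferredPrefix_iff, D.inv_mul_le_iff, mul_assoc, D.inv_mul_le_iff]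
  refine and_congr ?_ (and_congr ?_ Iff.rfl)
  · simp [conj, mul_assoc]
  · rw [← D.inv_mul_le_iff]
    simp [conj, mul_assoc]

-- Inversion exchanges `inf` with `-sup`, and so the first two terms of the gcd. Facts on `sup`
-- thereby reduce to facts on `inf`.
variable {D} in
lemma preferredPrefix_inv (hΔ : D.Δ ≠ 1) (z : G) :
    D.preferredPrefix z⁻¹ = D.preferredPrefix z := by
  refine D.eq_of_forall_le_iff fun e => ?_
  rw [le_preferredPrefix_iff, le_preferredPrefix_iff, inf_inv hΔ, sup_inv hΔ,
    D.mul_zpow_le_iff, neg_neg, D.le_inv_mul_iff, D.inv_mul_le_iff, ← D.mul_zpow_le_iff]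
  tauto

variable {D} in
lemma sliding_inv (hΔ : D.Δ ≠ 1) (z : G) : D.sliding z⁻¹ = (D.sliding z)⁻¹ := by
  rw [sliding, preferredPrefix_inv hΔ, conj_inv, sliding]

variable {D} in
lemma iterate_sliding_inv (hΔ : D.Δ ≠ 1) (n : ℕ) (z : G) :
    D.sliding^[n] z⁻¹ = (D.sliding^[n] z)⁻¹ := by
  induction n with
  | zero => rfl
  | succ n ih => rw [Function.iterate_succ_apply', ih, sliding_inv hΔ, Function.iterate_succ_apply']

variable {D} in
lemma inf_le_inf_sliding (hΔ : D.Δ ≠ 1) (z : G) : D.inf z ≤ D.inf (D.sliding z) := by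
  obtain ⟨h1, h2, h3⟩ := (D.le_preferredPrefix_iff _ z).1 (D.le_refl _)
  rw [sliding, le_inf_conj_iff hΔ, ← D.inv_mul_le_iff, le_preferredPrefix_iff]
  have hinf : D.le (D.Δ ^ D.inf z) z := (le_inf_iff hΔ _ _).1 _root_.le_rfl
  have hsup : D.le z (D.Δ ^ D.sup z) := (sup_le_iff hΔ _ _).1 _root_.le_rfl
  refine ⟨?_, ?_, ?_⟩
  · rw [mul_assoc, D.inv_mul_le_iff]
    refine ((D.mul_zpow_le_mul_zpow_iff _ _ _).2 h1).trans ?_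
    exact (D.mul_le_mul_left_iff _ _ _).2 hinf
  · rw [mul_inv_cancel_left]
    exact h1.trans hsup
  · rw [D.inv_mul_le_iff]
    exact h1.trans (D.le_mul_of_mem _ D.Δ_mem)

variable {D} in
lemma sup_sliding_le_sup (hΔ : D.Δ ≠ 1) (z : G) : D.sup (D.sliding z) ≤ D.sup z := by
  have := inf_le_inf_sliding hΔ z⁻¹
  rw [sliding_inv hΔ, inf_inv hΔ, inf_inv hΔ] at this
  omega

variable {D} in
lemma inf_le_inf_iterate_sliding (hΔ : D.Δ ≠ 1) (z : G) (n : ℕ) :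
    D.inf z ≤ D.inf (D.sliding^[n] z) := by
  induction n with
  | zero => exact _root_.le_rfl
  | succ n ih =>
    rw [Function.iterate_succ_apply']
    exact ih.trans (inf_le_inf_sliding hΔ _)

variable {D} in
lemma inf_iterate_sliding (hΔ : D.Δ ≠ 1) {z : G} {m : ℕ} (hm : 1 ≤ m) (hz : D.sliding^[m] z = z)
    (n : ℕ) : D.inf (D.sliding^[n] z) = D.inf z := by
  refine le_antisymm ?_ (inf_le_inf_iterate_sliding hΔ z n)
  -- After `n` slidings, another `m * n - n` lead back to `z`.
  have h := inf_le_inf_iterate_sliding hΔ (D.sliding^[n] z) (m * n - n)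
  have hn : n ≤ m * n := Nat.le_mul_of_pos_left n hm
  rwa [← Function.iterate_add_apply, Nat.sub_add_cancel hn, Function.iterate_mul,
    Function.iterate_fixed hz] at h

variable {D} in
lemma sup_iterate_sliding (hΔ : D.Δ ≠ 1) {z : G} {m : ℕ} (hm : 1 ≤ m) (hz : D.sliding^[m] z = z)
    (n : ℕ) : D.sup (D.sliding^[n] z) = D.sup z := by
  have h := inf_iterate_sliding hΔ (z := z⁻¹) hm (by rw [iterate_sliding_inv hΔ, hz]) n
  rw [iterate_sliding_inv hΔ, inf_inv hΔ, inf_inv hΔ] at h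
  omega

/-! ### Closed form for iterated sliding -/

/-- `z ^ m * e * Δ ^ j ≼ 1`. -/
def twistedLe (z : G) (m j : ℤ) (e : G) : Prop := D.le (z ^ m * e * D.Δ ^ j) 1

lemma twistedLe_mul_iff (z : G) (m j i h : ℤ) (e : G) :
    D.twistedLe z m j (z ^ i * e * D.Δ ^ h) ↔ D.twistedLe z (m + i) (j + h) e := by
  rw [twistedLe, twistedLe, zpow_add, add_comm j, zpow_add]
  simp only [mul_assoc]

variable {D} in
lemma twistedLe.mono {z : G} {m j : ℤ} {e : G} (h : D.twistedLe z m j e) {j' : ℤ} (hj : j' ≤ j) :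
    D.twistedLe z m j' e :=
  (D.mul_zpow_le_mul_zpow _ hj).trans h

/-- A greatest common divisor of `z ^ a * Δ ^ (-a * (k + 1))` and `z ^ (-a) * Δ ^ (a * (l - 1))`,
for `a ≤ n`. -/
noncomputable def slidingGcd (z : G) (k l : ℤ) (n : ℕ) : G :=
  D.gcd (D.gcdUpTo (fun a => z ^ (a : ℤ) * D.Δ ^ (-(a * (k + 1)))) n)
    (D.gcdUpTo (fun a => z ^ (-(a : ℤ)) * D.Δ ^ (a * (l - 1))) n)

lemma le_zpow_mul_zpow_iff (z e : G) (m j : ℤ) :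
    D.le e (z ^ m * D.Δ ^ j) ↔ D.twistedLe z (-m) (-j) e := by
  rw [twistedLe, D.mul_zpow_le_iff, neg_neg, zpow_neg, D.inv_mul_le_iff, one_mul]

lemma le_slidingGcd_iff (z e : G) (k l : ℤ) (n : ℕ) : D.le e (D.slidingGcd z k l n) ↔
    (∀ a ≤ n, D.twistedLe z (-a) (a * (k + 1)) e) ∧
    ∀ a ≤ n, D.twistedLe z a (-(a * (l - 1))) e := by
  simp only [slidingGcd, le_gcd_iff, le_gcdUpTo_iff, le_zpow_mul_zpow_iff, neg_neg]

/-- Shifting an element that precedes all terms with indices up to `n` and the next term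
of the first sequence. -/
lemma shift_le_slidingGcd {z e : G} {k l : ℤ} (hkl : k + 2 ≤ l) {n : ℕ}
    (h1 : ∀ a ≤ n + 1, D.twistedLe z (-a) (a * (k + 1)) e)
    (h2 : ∀ a ≤ n, D.twistedLe z a (-(a * (l - 1))) e) :
    D.le (z ^ (-1 : ℤ) * e * D.Δ ^ (k + 1)) (D.slidingGcd z k l n) := by
  rw [le_slidingGcd_iff]
  refine ⟨fun a ha => ?_, fun a ha => ?_⟩ <;> rw [twistedLe_mul_iff]
  · convert h1 (a + 1) (by omega) using 1
    · push_cast; ring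
    · push_cast; ring
  · rcases a with _ | a
    · convert h1 1 (by omega) using 1 <;> simp
    -- The shift turns the term of index `a + 1` into a weakening of that of index `a`, because `k +
    -- 1 ≤ l - 1`.
    · convert (h2 a (by omega)).mono (j' := -((a + 1 : ℕ) * (l - 1)) + (k + 1)) ?_ using 1
      · push_cast; ring
      · push_cast; linarith

lemma shift_le_slidingGcd' {z e : G} {k l : ℤ} (hkl : k + 2 ≤ l) {n : ℕ}
    (h1 : ∀ a ≤ n, D.twistedLe z (-a) (a * (k + 1)) e)
    (h2 : ∀ a ≤ n + 1, D.twistedLe z a (-(a * (l - 1))) e) :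
    D.le (z ^ (1 : ℤ) * e * D.Δ ^ (-(l - 1))) (D.slidingGcd z k l n) := by
  rw [le_slidingGcd_iff]
  refine ⟨fun a ha => ?_, fun a ha => ?_⟩ <;> rw [twistedLe_mul_iff]
  · rcases a with _ | a
    · convert h2 1 (by omega) using 1 <;> simp
    · convert (h1 a (by omega)).mono (j' := ((a + 1 : ℕ) * (k + 1)) + -(l - 1)) ?_ using 1
      · push_cast; ring
      · push_cast; linarith
  · convert h2 (a + 1) (by omega) using 1
    · push_cast; ring
    · push_cast; ring

/-- This recursion matches, up to a power of `Δ`, the three conditions defining the preferred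
prefix, one for each term of its gcd. -/
lemma le_slidingGcd_succ_iff {z e : G} {k l : ℤ} (hkl : k + 2 ≤ l) (n : ℕ) :
    D.le e (D.slidingGcd z k l (n + 1)) ↔
      D.le (z ^ (-1 : ℤ) * e * D.Δ ^ (k + 1)) (D.slidingGcd z k l n) ∧
      D.le (z ^ (1 : ℤ) * e * D.Δ ^ (-(l - 1))) (D.slidingGcd z k l n) ∧
      D.le e (D.slidingGcd z k l n) := by
  rw [le_slidingGcd_iff]
  constructor
  · rintro ⟨h1, h2⟩
    have h1' : ∀ a ≤ n, D.twistedLe z (-a) (a * (k + 1)) e := fun a ha => h1 a (by omega)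
    have h2' : ∀ a ≤ n, D.twistedLe z a (-(a * (l - 1))) e := fun a ha => h2 a (by omega)
    exact ⟨D.shift_le_slidingGcd hkl h1 h2', D.shift_le_slidingGcd' hkl h1' h2,
      (D.le_slidingGcd_iff _ _ _ _ _).2 ⟨h1', h2'⟩⟩
  · simp only [le_slidingGcd_iff, twistedLe_mul_iff]
    rintro ⟨⟨h1, -⟩, ⟨-, h2⟩, h3, h4⟩
    refine ⟨fun a ha => ?_, fun a ha => ?_⟩
    · rcases Nat.lt_or_ge n a with h | h
      · obtain rfl : a = n + 1 := by omega
        convert h1 n _root_.le_rfl using 1 <;> push_cast <;> ring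
      · exact h3 a h
    · rcases Nat.lt_or_ge n a with h | h
      · obtain rfl : a = n + 1 := by omega
        convert h2 n _root_.le_rfl using 1 <;> push_cast <;> ring
      · exact h4 a h

lemma slidingGcd_zero (z : G) (k l : ℤ) : D.slidingGcd z k l 0 = 1 := by
  refine D.eq_of_forall_le_iff fun e => ?_
  simp [le_slidingGcd_iff, twistedLe]

/-- Along a sliding circuit, iterated sliding is conjugation by `slidingGcd`. -/
lemma iterate_sliding_eq {z : G} (hkl : D.inf z + 2 ≤ D.sup z)
    (hinf : ∀ n, D.inf (D.sliding^[n] z) = D.inf z)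
    (hsup : ∀ n, D.sup (D.sliding^[n] z) = D.sup z) (n : ℕ) :
    D.sliding^[n] z = conj z (D.slidingGcd z (D.inf z) (D.sup z) n * D.Δ ^ (n : ℤ)) := by
  induction n with
  | zero => simp [slidingGcd_zero, conj]
  | succ n ih =>
    rw [Function.iterate_succ_apply', ih, sliding, ← conj_mul]
    have h1 := hinf n
    have h2 := hsup n
    rw [ih] at h1 h2
    congr 1
    refine D.eq_of_forall_le_iff fun e => ?_
    rw [le_mul_preferredPrefix_conj_iff, h1, h2,
      ← neg_neg ((n + 1 : ℕ) : ℤ), ← D.mul_zpow_le_iff, le_slidingGcd_succ_iff D hkl]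
    set K := D.slidingGcd z (D.inf z) (D.sup z) n
    have e1 : e * D.Δ ^ (-((n + 1 : ℕ) : ℤ)) = e * D.Δ ^ (-1 : ℤ) * D.Δ ^ (-(n : ℤ)) := by
      push_cast; group
    refine and_congr ?_ (and_congr ?_ ?_)
    · rw [← D.mul_zpow_le_mul_zpow_iff (-n) (e * _), ← D.mul_le_mul_left_iff z⁻¹]
      convert Iff.rfl using 2
      · push_cast; group
      · group
    · rw [← D.mul_zpow_le_mul_zpow_iff (-n - D.sup z) (z * e)]
      convert Iff.rfl using 2
      · push_cast; group
      · group
    · rw [← D.mul_zpow_le_mul_zpow_iff (-n - 1) e]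
      convert Iff.rfl using 2
      · push_cast; group
      · group

/-! ### Extremality of `inf` and `sup` on sliding circuits -/

variable {D} in
lemma zpow_mul_le_pow {k : ℤ} {w : G} (h : D.le (D.Δ ^ k) w) (a : ℕ) :
    D.le (D.Δ ^ (a * k)) (w ^ (a : ℤ)) := by
  induction a with
  | zero => simpa using D.le_refl 1
  | succ a ih =>
    have : D.Δ ^ (((a + 1 : ℕ) : ℤ) * k) = D.Δ ^ (a * k) * D.Δ ^ k := by
      rw [← zpow_add]; push_cast; ring_nf
    rw [this, Nat.cast_succ, zpow_add_one]
    exact ((D.mul_zpow_le_mul_zpow_iff _ _ _).2 ih).trans ((D.mul_le_mul_left_iff _ _ _).2 h)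

variable {D} in
/-- The infimum is maximal on a sliding circuit. -/
lemma inf_conj_le_inf (hΔ : D.Δ ≠ 1) {z : G} {m : ℕ} (hm : 1 ≤ m) (hz : D.sliding^[m] z = z)
    (c : G) : D.inf (conj z c) ≤ D.inf z := by
  by_contra! hlt
  set k := D.inf z with hk
  set f : ℕ → G := fun a => z ^ (a : ℤ) * D.Δ ^ (-(a * (k + 1))) with hf
  obtain ⟨p, q, hp, hq⟩ := D.exists_zpow_le_le c
  -- From `Δ ^ p ≼ c ≼ Δ ^ q` and `c * Δ ^ (a * (k + 1)) ≼ z ^ a * c`.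
  have hbound : ∀ a, D.le (D.Δ ^ (p - q)) (f a) := by
    intro a
    have h1 : D.le (D.Δ ^ (a * (k + 1))) (conj z c ^ (a : ℤ)) :=
      zpow_mul_le_pow ((le_inf_iff hΔ _ _).1 hlt) a
    have h2 : conj z c ^ (a : ℤ) = c⁻¹ * (z ^ (a : ℤ) * c) := by
      have := _root_.conj_pow (i := a) (a := c⁻¹) (b := z)
      rw [inv_inv] at this
      rw [conj, zpow_natCast, zpow_natCast, this, mul_assoc]
    rw [h2, D.le_inv_mul_iff] at h1
    have h3 := (((D.mul_zpow_le_mul_zpow_iff (a * (k + 1)) _ _).2 hp).trans h1).trans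
      ((D.mul_le_mul_left_iff (z ^ (a : ℤ)) _ _).2 hq)
    rw [← D.mul_zpow_le_mul_zpow_iff (-(a * (k + 1)) - q)] at h3
    convert h3 using 1
    · group
    · simp only [hf]; group
  obtain ⟨n, hn⟩ := D.exists_gcdUpTo_le hbound
  -- The closed form needs `inf z + 2 ≤ sup z`. Otherwise `f` is decreasing, and its stabilization
  -- gives `Δ ^ (k + 1) ≼ z` directly.
  rcases _root_.le_or_gt (D.sup z) (k + 1) with hs | hs
  · have hz1 : D.le z (D.Δ ^ (k + 1)) := (sup_le_iff hΔ _ _).1 hs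
    have hanti : ∀ a, D.le (f (a + 1)) (f a) := by
      intro a
      have := (D.mul_zpow_le_mul_zpow_iff (-((a + 1) * (k + 1))) _ _).2
        ((D.mul_le_mul_left_iff (z ^ (a : ℤ)) _ _).2 hz1)
      convert this using 1
      · simp only [hf]; push_cast; group
      · simp only [hf]; group
    have hle : ∀ a b, a ≤ b → D.le (f b) (f a) := by
      intro a b hab
      induction b, hab using Nat.le_induction with
      | base => exact D.le_refl _
      | succ b _ ih => exact (hanti b).trans ih
    have h1 : D.le (f n) (f (n + 1)) :=
      ((D.le_gcdUpTo_iff f n _).2 fun i hi => hle i n hi).trans hn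
    rw [← D.mul_zpow_le_mul_zpow_iff ((n + 1) * (k + 1)),
      ← D.mul_le_mul_left_iff (z ^ (-(n : ℤ)))] at h1
    have h2 : D.le (D.Δ ^ (k + 1)) z := by
      convert h1 using 1
      · simp only [hf]; group
      · simp only [hf]; push_cast; group
    have := (le_inf_iff hΔ _ _).2 h2
    omega
  · have hkl : D.inf z + 2 ≤ D.sup z := by omega
    have hi := inf_iterate_sliding hΔ hm hz
    have heq := D.iterate_sliding_eq hkl hi (sup_iterate_sliding hΔ hm hz) n
    have hlt' : D.inf z + 1 ≤ D.inf (D.sliding^[n] z) := by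
      rw [heq, le_inf_conj_iff hΔ]
      set K := D.slidingGcd z (D.inf z) (D.sup z) n with hK
      obtain ⟨h1, h2⟩ := (D.le_slidingGcd_iff z K _ _ n).1 (D.le_refl _)
      have h3 : D.le K (f (n + 1)) :=
        ((D.le_gcd_iff K _ _).1 (D.le_refl _)).1.trans hn
      rw [hf, le_zpow_mul_zpow_iff, neg_neg] at h3
      -- By stabilization `K` also precedes the next term of the first sequence, so its shift
      -- precedes `K`. This says that the infimum after `n` slidings is at least `k + 1`.
      have h4 := D.shift_le_slidingGcd (e := K) hkl (n := n) (fun a ha => by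
        rcases Nat.lt_or_ge n a with h | h
        · obtain rfl : a = n + 1 := by omega
          exact h3
        · exact h1 a h) h2
      rw [← hK, ← D.mul_le_mul_left_iff z, ← D.mul_zpow_le_mul_zpow_iff n] at h4
      convert h4 using 1
      · group
      · group
    rw [hi n] at hlt'
    omega

variable {D} in
lemma sup_le_sup_conj (hΔ : D.Δ ≠ 1) {z : G} {m : ℕ} (hm : 1 ≤ m) (hz : D.sliding^[m] z = z)
    (c : G) : D.sup z ≤ D.sup (conj z c) := by
  have h := inf_conj_le_inf hΔ (z := z⁻¹) hm (by rw [iterate_sliding_inv hΔ, hz]) c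
  rw [conj_inv, inf_inv hΔ, inf_inv hΔ] at h
  omega

end GarsideStructure

namespace GarsideStructure

variable {G : Type*} [Group G] {D : GarsideStructure G}

/-! ### Super summit sets and sliding circuits -/

lemma SC_subset_SSS (hΔ : D.Δ ≠ 1) (x : G) : D.SC x ⊆ D.SSS x := by
  rintro z ⟨hxz, m, hm, hz⟩
  refine ⟨hxz, ⟨⟨z, hxz, rfl⟩, ?_⟩, ⟨⟨z, hxz, rfl⟩, ?_⟩⟩
  · rintro _ ⟨w, hw, rfl⟩
    obtain ⟨c, rfl⟩ := exists_eq_conj (hxz.symm.trans hw)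
    exact inf_conj_le_inf hΔ hm hz c
  · rintro _ ⟨w, hw, rfl⟩
    obtain ⟨c, rfl⟩ := exists_eq_conj (hxz.symm.trans hw)
    exact sup_le_sup_conj hΔ hm hz c

lemma inf_eq_of_mem_SSS {x y z : G} (hy : y ∈ D.SSS x) (hz : z ∈ D.SSS x) : D.inf y = D.inf z :=
  hy.2.1.unique hz.2.1

lemma sup_eq_of_mem_SSS {x y z : G} (hy : y ∈ D.SSS x) (hz : z ∈ D.SSS x) : D.sup y = D.sup z :=
  hy.2.2.unique hz.2.2

lemma conj_mem_SSS {x y : G} (hy : y ∈ D.SSS x) {a : G} (h1 : D.inf y ≤ D.inf (conj y a))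
    (h2 : D.sup (conj y a) ≤ D.sup y) : conj y a ∈ D.SSS x := by
  have hc : IsConj x (conj y a) := hy.1.trans (isConj_conj y a)
  have e1 : D.inf (conj y a) = D.inf y := le_antisymm (hy.2.1.2 ⟨_, hc, rfl⟩) h1
  have e2 : D.sup (conj y a) = D.sup y := le_antisymm h2 (hy.2.2.2 ⟨_, hc, rfl⟩)
  refine ⟨hc, ?_, ?_⟩
  · rw [e1]; exact hy.2.1
  · rw [e2]; exact hy.2.2

lemma sliding_mem_SSS (hΔ : D.Δ ≠ 1) {x y : G} (hy : y ∈ D.SSS x) : D.sliding y ∈ D.SSS x :=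
  conj_mem_SSS hy (inf_le_inf_sliding hΔ y) (sup_sliding_le_sup hΔ y)

lemma iterate_sliding_mem_SSS (hΔ : D.Δ ≠ 1) {x y : G} (hy : y ∈ D.SSS x) (n : ℕ) :
    D.sliding^[n] y ∈ D.SSS x := by
  induction n with
  | zero => exact hy
  | succ n ih => rw [Function.iterate_succ_apply']; exact sliding_mem_SSS hΔ ih

/-- The conditions `u * Δ ^ k ≼ y * u` and `y * u ≼ u * Δ ^ l` pass to gcds, as left multiplication
and right multiplication by powers of `Δ` are order automorphisms. -/
lemma conj_gcd_mem_SSS (hΔ : D.Δ ≠ 1) {x y a b : G} (hy : y ∈ D.SSS x)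
    (ha : conj y a ∈ D.SSS x) (hb : conj y b ∈ D.SSS x) : conj y (D.gcd a b) ∈ D.SSS x := by
  obtain ⟨h1, h2⟩ := (D.le_gcd_iff _ a b).1 (D.le_refl _)
  have ia := (le_inf_conj_iff hΔ _ _ _).1 (inf_eq_of_mem_SSS hy ha).le
  have ib := (le_inf_conj_iff hΔ _ _ _).1 (inf_eq_of_mem_SSS hy hb).le
  have sa := (sup_conj_le_iff hΔ _ _ _).1 (sup_eq_of_mem_SSS hy ha).ge
  have sb := (sup_conj_le_iff hΔ _ _ _).1 (sup_eq_of_mem_SSS hy hb).ge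
  refine conj_mem_SSS hy ?_ ?_
  · rw [le_inf_conj_iff hΔ, ← D.inv_mul_le_iff, le_gcd_iff, D.inv_mul_le_iff, D.inv_mul_le_iff]
    exact ⟨((D.mul_zpow_le_mul_zpow_iff _ _ _).2 h1).trans ia,
      ((D.mul_zpow_le_mul_zpow_iff _ _ _).2 h2).trans ib⟩
  · rw [sup_conj_le_iff hΔ, ← neg_neg (D.sup y), ← D.mul_zpow_le_iff, le_gcd_iff,
      D.mul_zpow_le_iff, D.mul_zpow_le_iff, neg_neg]
    exact ⟨((D.mul_le_mul_left_iff _ _ _).2 h1).trans sa,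
      ((D.mul_le_mul_left_iff _ _ _).2 h2).trans sb⟩

lemma conj_Δ_mem_SSS (hΔ : D.Δ ≠ 1) {x y : G} (hy : y ∈ D.SSS x) : conj y D.Δ ∈ D.SSS x := by
  refine conj_mem_SSS hy ?_ ?_
  · rw [le_inf_conj_iff hΔ, ← zpow_one_add, add_comm, zpow_add_one]
    have := (D.mul_zpow_le_mul_zpow_iff 1 _ _).2 ((le_inf_iff hΔ _ _).1 (_root_.le_refl (D.inf y)))
    simpa using this
  · rw [sup_conj_le_iff hΔ, ← zpow_one_add, add_comm, zpow_add_one]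
    have := (D.mul_zpow_le_mul_zpow_iff 1 _ _).2 ((sup_le_iff hΔ _ _).1 (_root_.le_refl (D.sup y)))
    simpa using this

lemma sliding_mem_SC {x z : G} (hz : z ∈ D.SC x) : D.sliding z ∈ D.SC x := by
  obtain ⟨hxz, m, hm, h⟩ := hz
  refine ⟨hxz.trans (isConj_conj _ _), m, hm, ?_⟩
  rw [← Function.iterate_succ_apply, Function.iterate_succ_apply', h]

lemma iterate_sliding_mem_SC {x z : G} (hz : z ∈ D.SC x) (n : ℕ) : D.sliding^[n] z ∈ D.SC x := by
  induction n with
  | zero => exact hz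
  | succ n ih => rw [Function.iterate_succ_apply']; exact sliding_mem_SC ih

lemma mem_periodicPts_of_mem_SC {x z : G} (hz : z ∈ D.SC x) :
    z ∈ Function.periodicPts D.sliding := by
  obtain ⟨-, m, hm, h⟩ := hz
  exact Function.mk_mem_periodicPts hm h

lemma prev_mem_SC {x z : G} (hz : z ∈ D.SC x) : D.prev z ∈ D.SC x :=
  iterate_sliding_mem_SC hz _

lemma iterate_prev_mem_SC {x z : G} (hz : z ∈ D.SC x) (n : ℕ) : D.prev^[n] z ∈ D.SC x := by
  induction n with
  | zero => exact hz
  | succ n ih => rw [Function.iterate_succ_apply']; exact prev_mem_SC ih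

lemma sliding_prev {x z : G} (hz : z ∈ D.SC x) : D.sliding (D.prev z) = z := by
  have h := Function.minimalPeriod_pos_of_mem_periodicPts (mem_periodicPts_of_mem_SC hz)
  rw [prev, ← Function.iterate_succ_apply' D.sliding, Nat.succ_eq_add_one, Nat.sub_add_cancel h]
  exact Function.iterate_minimalPeriod

lemma prev_sliding {x z : G} (hz : z ∈ D.SC x) : D.prev (D.sliding z) = z := by
  have hp := mem_periodicPts_of_mem_SC hz
  have h := Function.minimalPeriod_pos_of_mem_periodicPts hp
  rw [prev, Function.minimalPeriod_apply hp, ← Function.iterate_succ_apply, Nat.succ_eq_add_one,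
    Nat.sub_add_cancel h]
  exact Function.iterate_minimalPeriod

lemma iterate_prev_iterate_sliding {x z : G} (hz : z ∈ D.SC x) (n : ℕ) :
    D.prev^[n] (D.sliding^[n] z) = z := by
  induction n with
  | zero => rfl
  | succ n ih =>
    rw [Function.iterate_succ_apply' D.sliding, Function.iterate_succ_apply,
      prev_sliding (iterate_sliding_mem_SC hz n), ih]

/-! ### Transport -/

lemma conj_transport (z a : G) :
    conj (D.sliding z) (D.transport z a) = D.sliding (conj z a) := by
  simp [conj, sliding, transport, mul_assoc]

/-- On the super summit set `inf` and `sup` are constant, so `a` enters only through the upper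
bounds on the right. Monotonicity and compatibility with gcds can be read off. -/
lemma le_transport_iff {x z a : G} (hz : z ∈ D.SSS x) (ha : conj z a ∈ D.SSS x) (e : G) :
    D.le e (D.transport z a) ↔
      D.le (D.preferredPrefix z * e * D.Δ ^ D.inf z) (z * a) ∧
      D.le (z * (D.preferredPrefix z * e)) (a * D.Δ ^ D.sup z) ∧
      D.le (D.preferredPrefix z * e) (a * D.Δ) := by
  rw [transport, mul_assoc, D.le_inv_mul_iff, le_mul_preferredPrefix_conj_iff,
    inf_eq_of_mem_SSS ha hz, sup_eq_of_mem_SSS ha hz]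

lemma transport_one (z : G) : D.transport z 1 = 1 := by
  simp [transport, conj]

lemma transport_mono {x z a b : G} (hz : z ∈ D.SSS x) (ha : conj z a ∈ D.SSS x)
    (hb : conj z b ∈ D.SSS x) (hab : D.le a b) :
    D.le (D.transport z a) (D.transport z b) := by
  obtain ⟨h1, h2, h3⟩ := (le_transport_iff hz ha _).1 (D.le_refl _)
  refine (le_transport_iff hz hb _).2 ⟨h1.trans ((D.mul_le_mul_left_iff _ _ _).2 hab),
    h2.trans ((D.mul_zpow_le_mul_zpow_iff _ _ _).2 hab), h3.trans ?_⟩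
  simpa using (D.mul_zpow_le_mul_zpow_iff 1 _ _).2 hab

lemma one_le_transport {x z a : G} (hz : z ∈ D.SSS x) (ha : conj z a ∈ D.SSS x)
    (h : D.le 1 a) : D.le 1 (D.transport z a) := by
  have := transport_mono hz (a := 1) (by simpa [conj] using hz) ha h
  rwa [transport_one] at this

lemma conj_transport_mem_SSS (hΔ : D.Δ ≠ 1) {x z a : G} (ha : conj z a ∈ D.SSS x) :
    conj (D.sliding z) (D.transport z a) ∈ D.SSS x := by
  rw [conj_transport]
  exact sliding_mem_SSS hΔ ha

lemma le_transport_gcd (hΔ : D.Δ ≠ 1) {x z a b e : G} (hz : z ∈ D.SSS x)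
    (ha : conj z a ∈ D.SSS x) (hb : conj z b ∈ D.SSS x) (hea : D.le e (D.transport z a))
    (heb : D.le e (D.transport z b)) : D.le e (D.transport z (D.gcd a b)) := by
  obtain ⟨a1, a2, a3⟩ := (le_transport_iff hz ha _).1 hea
  obtain ⟨b1, b2, b3⟩ := (le_transport_iff hz hb _).1 heb
  have key : ∀ (k : ℤ) (u : G), D.le u (a * D.Δ ^ k) → D.le u (b * D.Δ ^ k) →
      D.le u (D.gcd a b * D.Δ ^ k) := by
    intro k u hu hv
    rw [← neg_neg k, ← D.mul_zpow_le_iff] at hu hv ⊢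
    exact (D.le_gcd_iff _ _ _).2 ⟨hu, hv⟩
  refine (le_transport_iff hz (conj_gcd_mem_SSS hΔ hz ha hb) _).2 ⟨?_, key _ _ a2 b2, ?_⟩
  · rw [← D.inv_mul_le_iff] at a1 b1 ⊢
    exact (D.le_gcd_iff _ _ _).2 ⟨a1, b1⟩
  · simpa using key 1 _ (by simpa using a3) (by simpa using b3)

/-- Conjugation by `Δ` is an automorphism respecting the preferred prefix. Together with
monotonicity this keeps transports of simple elements below `Δ`, and it makes `Δ` a candidate for
the pullback of any `s ≼ Δ`. -/
lemma transport_Δ (hΔ : D.Δ ≠ 1) {x z : G} (hz : z ∈ D.SSS x) : D.transport z D.Δ = D.Δ := by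
  have hkey : D.Δ * D.preferredPrefix (conj z D.Δ) = D.preferredPrefix z * D.Δ := by
    refine D.eq_of_forall_le_iff fun e => ?_
    have hc := conj_Δ_mem_SSS hΔ hz
    have h1 := D.mul_zpow_le_iff (-1) e (D.preferredPrefix z)
    rw [neg_neg, zpow_one] at h1
    rw [le_mul_preferredPrefix_conj_iff, inf_eq_of_mem_SSS hc hz, sup_eq_of_mem_SSS hc hz, ← h1,
      le_preferredPrefix_iff]
    refine and_congr ?_ (and_congr ?_ ?_)
    · rw [← D.mul_zpow_le_mul_zpow_iff (-1)]
      convert Iff.rfl using 2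
      · group
      · group
    · rw [← D.mul_zpow_le_mul_zpow_iff (-1)]
      convert Iff.rfl using 2
      · group
      · group
    · rw [← D.mul_zpow_le_mul_zpow_iff (-1)]
      convert Iff.rfl using 2
      group
  rw [transport, mul_assoc, hkey, inv_mul_cancel_left]

lemma iterTransport_succ' (z a : G) (n : ℕ) :
    D.iterTransport z a (n + 1) = D.iterTransport (D.sliding z) (D.transport z a) n := by
  induction n with
  | zero => rfl
  | succ n ih =>
    rw [iterTransport, ih, iterTransport, Function.iterate_succ_apply]

lemma iterTransport_add (z a : G) (m n : ℕ) :
    D.iterTransport z a (m + n) = D.iterTransport (D.sliding^[m] z) (D.iterTransport z a m) n := by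
  induction n with
  | zero => rfl
  | succ n ih =>
    rw [← add_assoc, iterTransport, ih, iterTransport, ← Function.iterate_add_apply, add_comm]

lemma iterTransport_mul {z : G} {N : ℕ} (hN : D.sliding^[N] z = z) (a : G) (i : ℕ) :
    D.iterTransport z a (i * N) = (fun t => D.iterTransport z t N)^[i] a := by
  induction i with
  | zero => simp [iterTransport]
  | succ i ih =>
    rw [Function.iterate_succ_apply', ← ih, Nat.succ_mul, iterTransport_add, mul_comm i,
      Function.iterate_mul, Function.iterate_fixed hN]

lemma conj_iterTransport (z a : G) (n : ℕ) :
    conj (D.sliding^[n] z) (D.iterTransport z a n) = D.sliding^[n] (conj z a) := by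
  induction n with
  | zero => rfl
  | succ n ih =>
    rw [Function.iterate_succ_apply', Function.iterate_succ_apply', iterTransport, conj_transport,
      ih]

lemma conj_iterTransport_mem_SSS (hΔ : D.Δ ≠ 1) {x z a : G} (ha : conj z a ∈ D.SSS x) (n : ℕ) :
    conj (D.sliding^[n] z) (D.iterTransport z a n) ∈ D.SSS x := by
  rw [conj_iterTransport]
  exact iterate_sliding_mem_SSS hΔ ha n

lemma iterTransport_mono (hΔ : D.Δ ≠ 1) {x z a b : G} (hz : z ∈ D.SSS x)
    (ha : conj z a ∈ D.SSS x) (hb : conj z b ∈ D.SSS x) (hab : D.le a b) (n : ℕ) :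
    D.le (D.iterTransport z a n) (D.iterTransport z b n) := by
  induction n with
  | zero => exact hab
  | succ n ih =>
    exact transport_mono (iterate_sliding_mem_SSS hΔ hz n) (conj_iterTransport_mem_SSS hΔ ha n)
      (conj_iterTransport_mem_SSS hΔ hb n) ih

lemma one_le_iterTransport (hΔ : D.Δ ≠ 1) {x z a : G} (hz : z ∈ D.SSS x)
    (ha : conj z a ∈ D.SSS x) (h : D.le 1 a) (n : ℕ) : D.le 1 (D.iterTransport z a n) := by
  induction n with
  | zero => exact h
  | succ n ih =>
    exact one_le_transport (iterate_sliding_mem_SSS hΔ hz n) (conj_iterTransport_mem_SSS hΔ ha n) ih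

lemma iterTransport_Δ (hΔ : D.Δ ≠ 1) {x z : G} (hz : z ∈ D.SSS x) (n : ℕ) :
    D.iterTransport z D.Δ n = D.Δ := by
  induction n with
  | zero => rfl
  | succ n ih => rw [iterTransport, ih, transport_Δ hΔ (iterate_sliding_mem_SSS hΔ hz n)]

/-! ### Pullback -/

lemma one_le_Δ : D.le 1 D.Δ := (D.one_le_iff _).2 D.Δ_mem

lemma exists_isPullback (hΔ : D.Δ ≠ 1) {x y s : G} (hy : y ∈ D.SC x) (hs : D.le s D.Δ) :
    ∃ t, D.IsPullback x y s t := by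
  have hz := SC_subset_SSS hΔ x (prev_mem_SC hy)
  obtain ⟨t, ht, hmin⟩ := D.exists_least
    (A := {t | D.le 1 t ∧ conj (D.prev y) t ∈ D.SSS x ∧ D.le s (D.transport (D.prev y) t)})
    (fun a ha => (D.one_le_iff a).1 ha.1)
    ⟨D.Δ, one_le_Δ, conj_Δ_mem_SSS hΔ hz, by rwa [transport_Δ hΔ hz]⟩
    (fun a ha b hb => ⟨(D.le_gcd_iff _ _ _).2 ⟨ha.1, hb.1⟩, conj_gcd_mem_SSS hΔ hz ha.2.1 hb.2.1,
      le_transport_gcd hΔ hz ha.2.1 hb.2.1 ha.2.2 hb.2.2⟩)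
  exact ⟨t, ht, fun t' h1 h2 h3 => hmin t' ⟨h1, h2, h3⟩⟩

lemma IsPullback.le_Δ (hΔ : D.Δ ≠ 1) {x y s t : G} (hy : y ∈ D.SC x) (hs : D.le s D.Δ)
    (h : D.IsPullback x y s t) : D.le t D.Δ := by
  have hz := SC_subset_SSS hΔ x (prev_mem_SC hy)
  exact h.2 _ one_le_Δ (conj_Δ_mem_SSS hΔ hz) (by rwa [transport_Δ hΔ hz])

lemma IsPullback.le_iff (hΔ : D.Δ ≠ 1) {x y s t : G} (hy : y ∈ D.SC x)
    (h : D.IsPullback x y s t) {u : G} (hu : D.le 1 u) (hu' : conj (D.prev y) u ∈ D.SSS x) :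
    D.le t u ↔ D.le s (D.transport (D.prev y) u) :=
  ⟨fun htu => h.1.2.2.trans
    (transport_mono (SC_subset_SSS hΔ x (prev_mem_SC hy)) h.1.2.1 hu' htu), h.2 u hu hu'⟩

lemma isPullback_pullback (hΔ : D.Δ ≠ 1) {x y s : G} (hy : y ∈ D.SC x) (hs : D.le s D.Δ) :
    D.IsPullback x y s (D.pullback x y s) :=
  Classical.epsilon_spec (exists_isPullback hΔ hy hs)

lemma isPullback_iterPullback (hΔ : D.Δ ≠ 1) {x z s : G} (hz : z ∈ D.SC x) (hs : D.le s D.Δ)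
    (m : ℕ) : D.le (D.iterPullback x z s m) D.Δ ∧ D.IsPullback x (D.prev^[m] z)
      (D.iterPullback x z s m) (D.iterPullback x z s (m + 1)) := by
  induction m with
  | zero => exact ⟨hs, isPullback_pullback hΔ hz hs⟩
  | succ m ih =>
    have h := ih.2.le_Δ hΔ (iterate_prev_mem_SC hz m) ih.1
    exact ⟨h, isPullback_pullback hΔ (iterate_prev_mem_SC hz (m + 1)) h⟩

lemma iterPullback_mem (hΔ : D.Δ ≠ 1) {x z s : G} (hz : z ∈ D.SC x) (hs : s ∈ D.simples)
    (hzs : conj z s ∈ D.SSS x) (m : ℕ) : D.iterPullback x z s m ∈ D.simples ∧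
      conj (D.prev^[m] z) (D.iterPullback x z s m) ∈ D.SSS x := by
  cases m with
  | zero => exact ⟨hs, hzs⟩
  | succ m =>
    have h := (isPullback_iterPullback hΔ hz hs.2 m).2
    refine ⟨⟨h.1.1, (isPullback_iterPullback hΔ hz hs.2 (m + 1)).1⟩, ?_⟩
    rw [Function.iterate_succ_apply']
    exact h.1.2.1

/-- Iterated pullback is left adjoint to iterated transport. -/
lemma iterPullback_le_iff (hΔ : D.Δ ≠ 1) {x z s : G} (hz : z ∈ D.SC x) (hs : D.le s D.Δ) (m : ℕ)
    {u : G} (hu : D.le 1 u) (hu' : conj (D.prev^[m] z) u ∈ D.SSS x) :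
    D.le (D.iterPullback x z s m) u ↔ D.le s (D.iterTransport (D.prev^[m] z) u m) := by
  induction m generalizing u with
  | zero => rfl
  | succ m ih =>
    have hy := iterate_prev_mem_SC hz m
    have hy' := SC_subset_SSS hΔ x (prev_mem_SC hy)
    rw [Function.iterate_succ_apply'] at hu' ⊢
    have hc := conj_transport_mem_SSS hΔ hu'
    -- The last pullback is adjoint to the first transport, which moves the base point from `prev^[m
    -- + 1] z` to `prev^[m] z`.
    rw [(isPullback_iterPullback hΔ hz hs m).2.le_iff hΔ hy hu hu', iterTransport_succ',
      sliding_prev hy]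
    rw [sliding_prev hy] at hc
    exact ih (one_le_transport hy' hu' hu) hc

end GarsideStructure

/-- Let `F` be a monotone self-map of a set `V` with a reflexive and transitive relation `r`, all of
whose orbits repeat within `R` steps, and let `g i` represent `s ≼ F^[i] t`. Then the sequence `g`
repeats, up to equivalence, within `2 * R` steps. -/
lemma exists_repetition_of_adjunction {α : Type*} {r : α → α → Prop} (hrefl : ∀ a, r a a)
    (htrans : ∀ a b c, r a b → r b c → r a c) {V : Set α} {F : α → α} (hFV : ∀ t ∈ V, F t ∈ V)
    (hF : ∀ a ∈ V, ∀ b ∈ V, r a b → r (F a) (F b)) {R : ℕ}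
    (hR : ∀ t ∈ V, ∃ i j, i < j ∧ j ≤ R ∧ F^[i] t = F^[j] t) {s : α} {g : ℕ → α}
    (hg : ∀ i, g i ∈ V) (hadj : ∀ i, ∀ t ∈ V, r (g i) t ↔ r s (F^[i] t)) :
    ∃ i j, i < j ∧ j ≤ 2 * R ∧ r (g i) (g j) ∧ r (g j) (g i) := by
  have hFV' : ∀ n, ∀ t ∈ V, F^[n] t ∈ V := fun n t ht =>
    Set.MapsTo.iterate (s := V) hFV n ht
  have hF' : ∀ n, ∀ a ∈ V, ∀ b ∈ V, r a b → r (F^[n] a) (F^[n] b) := by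
    intro n
    induction n with
    | zero => exact fun _ _ _ _ h => h
    | succ n ih =>
      intro a ha b hb h
      rw [Function.iterate_succ_apply, Function.iterate_succ_apply]
      exact ih _ (hFV a ha) _ (hFV b hb) (hF a ha b hb h)
  have hper : ∀ t ∈ V, ∃ p, 1 ≤ p ∧ p ≤ R ∧ F^[p] (F^[R] t) = F^[R] t := by
    intro t ht
    obtain ⟨i, j, hij, hj, h⟩ := hR t ht
    refine ⟨j - i, by omega, by omega, ?_⟩
    rw [← Function.iterate_add_apply, show j - i + R = (R - i) + j by omega,
      Function.iterate_add_apply, ← h, ← Function.iterate_add_apply, Nat.sub_add_cancel (by omega)]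
  obtain ⟨p, hp1, hpR, hp⟩ := hper _ (hg R)
  obtain ⟨q, hq1, -, hq⟩ := hper _ (hg (R + p))
  have hsc : r s (F^[R] (g R)) := (hadj R _ (hg R)).1 (hrefl _)
  have hcV := hFV' R _ (hg R)
  have huV := hFV' R _ (hg (R + p))
  refine ⟨R, R + p, by omega, by omega, ?_, ?_⟩
  · have h1 : r s (F^[R + p] (g (R + p))) := (hadj _ _ (hg _)).1 (hrefl _)
    rw [Function.iterate_add_apply] at h1
    have h2 := (hadj R _ (hFV' p _ (hg (R + p)))).2 h1
    have h3 := hF' R _ (hg R) _ (hFV' p _ (hg (R + p))) h2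
    rw [((Function.Commute.refl F).iterate_iterate R p).eq] at h3
    -- Applying `F^[p]` fixes the left side and advances the right side. After `q` rounds, `q` being
    -- a period of `F^[R] (g (R + p))`, the right side returns to that element.
    have h4 : ∀ n, r (F^[R] (g R)) (F^[p * (n + 1)] (F^[R] (g (R + p)))) := by
      intro n
      induction n with
      | zero => rwa [zero_add, mul_one]
      | succ n ih =>
        have := hF' p _ hcV _ (hFV' _ _ huV) ih
        rwa [hp, ← Function.iterate_add_apply, add_comm p, ← Nat.mul_succ] at this
    have h5 := h4 (q - 1)
    rw [Nat.sub_add_cancel hq1, mul_comm, Function.iterate_mul, Function.iterate_fixed hq] at h5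
    exact (hadj R _ (hg _)).2 (htrans _ _ _ hsc h5)
  · rw [hadj _ _ (hg R), add_comm R p, Function.iterate_add_apply, hp]
    exact hsc

theorem corollaryC {G : Type*} [Group G] (D : GarsideStructure G) (hD : D.FiniteType) (x : G)
    (N : G → ℕ) (hN : ∀ z ∈ D.SC x, 1 ≤ N z ∧ D.sliding^[N z] z = z)
    (R : ℕ) (hR : D.IsTransportBound x N R)
    (z : G) (hz : z ∈ D.SC x) (s : G) (hs : s ∈ D.simples)
    (hzs : GarsideStructure.conj z s ∈ D.SSS x) :
    (∀ m : ℕ, D.IsPullback x (D.prev^[m] z) (D.iterPullback x z s m)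
      (D.iterPullback x z s (m + 1))) ∧
    ∃ i j : ℕ, i < j ∧ j ≤ 2 * R ∧
      D.iterPullback x z s (i * N z) = D.iterPullback x z s (j * N z) := by
  by_cases hΔ : D.Δ = 1
  · have hG := D.subsingleton_of_Δ_eq_one hΔ
    have hle : ∀ a b : G, D.le a b := fun a b => by
      rw [Subsingleton.elim a b]; exact D.le_refl b
    -- In the trivial group any pair of indices works; the hypothesis supplies one, which shows `R`
    -- is positive.
    obtain ⟨i, j, hij, hj, -⟩ := hR z hz s hs hzs
    refine ⟨fun m => ⟨⟨hle _ _, ?_, hle _ _⟩, fun _ _ _ _ => hle _ _⟩,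
      i, j, hij, by omega, Subsingleton.elim _ _⟩
    rwa [Subsingleton.elim (GarsideStructure.conj _ _) (GarsideStructure.conj z s)]
  · refine ⟨fun m => (GarsideStructure.isPullback_iterPullback hΔ hz hs.2 m).2, ?_⟩
    have hzS := GarsideStructure.SC_subset_SSS hΔ x hz
    obtain ⟨-, hNz⟩ := hN z hz
    have hprev : ∀ i, D.prev^[i * N z] z = z := by
      intro i
      have h := GarsideStructure.iterate_prev_iterate_sliding hz (i * N z)
      rwa [mul_comm, Function.iterate_mul D.sliding, Function.iterate_fixed hNz, mul_comm] at h
    -- The `N z`-fold transport acts on this set, since `z` returns to itself.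
    have hV : ∀ t ∈ {t | t ∈ D.simples ∧ GarsideStructure.conj z t ∈ D.SSS x},
        D.iterTransport z t (N z) ∈ {t | t ∈ D.simples ∧ GarsideStructure.conj z t ∈ D.SSS x} := by
      rintro t ⟨⟨h1, h2⟩, h3⟩
      refine ⟨⟨GarsideStructure.one_le_iterTransport hΔ hzS h3 h1 _, ?_⟩, ?_⟩
      · have := GarsideStructure.iterTransport_mono hΔ hzS h3 (GarsideStructure.conj_Δ_mem_SSS hΔ hzS) h2 (N z)
        rwa [GarsideStructure.iterTransport_Δ hΔ hzS] at this
      · have := GarsideStructure.conj_iterTransport_mem_SSS hΔ h3 (N z)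
        rwa [hNz] at this
    obtain ⟨i, j, hij, hj, h1, h2⟩ := exists_repetition_of_adjunction (R := R) (s := s)
      (g := fun i => D.iterPullback x z s (i * N z)) D.le_refl (fun _ _ _ h h' => h.trans h') hV
      (fun a ha b hb hab => GarsideStructure.iterTransport_mono hΔ hzS ha.2 hb.2 hab _)
      (fun t ht => by
        obtain ⟨i, j, hij, hj, h⟩ := hR z hz t ht.1 ht.2
        rw [GarsideStructure.iterTransport_mul hNz, GarsideStructure.iterTransport_mul hNz] at h
        exact ⟨i, j, hij, hj, h⟩)
      (fun i => by
        have h := GarsideStructure.iterPullback_mem hΔ hz hs hzs (i * N z)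
        rwa [hprev] at h)
      (fun i t ht => by
        have h := GarsideStructure.iterPullback_le_iff hΔ hz hs.2 (i * N z) ht.1.1 (by rw [hprev]; exact ht.2)
        rwa [hprev, GarsideStructure.iterTransport_mul hNz] at h)
    exact ⟨i, j, hij, hj, h1.antisymm h2⟩
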